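/- Let $\mathbb{H}$ be the quaternions, $\mathbb{S}=\{q\in\mathbb{H}: q^2=-1\}$ the sphere of imaginary units, and, for $I\in\mathbb{S}$, $L_I=\mathbb{R}+I\mathbb{R}\simeq\mathbb{C}$. For $x,y\in\mathbb{R}$ let $x+y\mathbb{S}=\{x+yJ : J\in\mathbb{S}\}$. A domain (non-empty connected open set) $\Omega\subseteq\mathbb{H}$ intersecting $\mathbb{R}$ is a slice domain if $\Omega_I=\Omega\cap L_I$ is a domain in $L_I$ for every $I\in\mathbb{S}$; it is symmetric if $x+yI\in\Omega$ with $x,y\in\mathbb{R}$, $I\in\mathbb{S}$ implies $x+y\mathbb{S}\subseteq\Omega$. A function $f:\Omega\to\mathbb{H}$ is regular if, for every $I\in\mathbb{S}$, the restriction $f_I=f|_{\Omega_I}$ is of class $C^1$ and $\frac12\left(\frac{\partial}{\partial x}+I\frac{\partial}{\partial y}\right)f_I(x+yI)=0$ for all $x+yI\in\Omega_I$. The degenerate set $D_f$ of $f$ is the union of the 2-spheres $x+y\mathbb{S}\subseteq\Omega$ with $x,y\in\mathbb{R}$, $y\neq0$, on which $f$ is constant. **Theorem.** Let $\Omega\subseteq\mathbb{H}$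 be a symmetric slice domain and let $f:\Omega\to\mathbb{H}$ be a non-constant regular function. Then $D_f$ is a subset of $\Omega\setminus\mathbb{R}$ that is closed in the relative topology of $\Omega\setminus\mathbb{R}$, and $D_f$ has empty interior. -/

import Mathlib

open scoped Quaternion

namespace SliceRegular

noncomputable section

/-- The 2-sphere `𝕊` of quaternionic imaginary units. -/
def imagUnits : Set ℍ := {q | q ^ 2 = -1}

/-- The real axis of `ℍ`. -/
def realAxis : Set ℍ := Set.range (fun x : ℝ => (x : ℍ))

/-- For `I ∈ 𝕊`, the identification `x + iy ↦ x + yI` of `ℂ` with the complex plane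
`L_I = ℝ + Iℝ` in `ℍ`. -/
def toPlane (I : ℍ) (z : ℂ) : ℍ := (z.re : ℍ) + (z.im : ℍ) * I

/-- The slice `Ω_I = Ω ∩ L_I`, as a subset of `ℂ ≃ L_I`. -/
def slice (Ω : Set ℍ) (I : ℍ) : Set ℂ := toPlane I ⁻¹' Ω

/-- The restriction `f_I` of `f` to `L_I ≃ ℂ`. Only its values on `slice Ω I` matter. -/
def restrict (f : ℍ → ℍ) (I : ℍ) : ℂ → ℍ := fun z => f (toPlane I z)

/-- The sphere `x + y𝕊`. -/
def sphere (x y : ℝ) : Set ℍ := {q | ∃ J ∈ imagUnits, q = (x : ℍ) + (y : ℍ) * J}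

/-- Axially symmetric subsets of `ℍ`. -/
def IsSymmetric (C : Set ℍ) : Prop :=
  ∀ (x y : ℝ), ∀ I ∈ imagUnits, (x : ℍ) + (y : ℍ) * I ∈ C → sphere x y ⊆ C

/-- Slice domains: domains of `ℍ` that meet the real axis and all of whose slices are domains
in `L_I ≃ ℂ`. -/
structure IsSliceDomain (Ω : Set ℍ) : Prop where
  isOpen : IsOpen Ω
  isConnected : IsConnected Ω
  inter_realAxis : (Ω ∩ realAxis).Nonempty
  isOpen_slice : ∀ I ∈ imagUnits, IsOpen (slice Ω I)
  isConnected_slice : ∀ I ∈ imagUnits, IsConnected (slice Ω I)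

/-- Symmetric slice domains. -/
def IsSymmetricSliceDomain (Ω : Set ℍ) : Prop := IsSliceDomain Ω ∧ IsSymmetric Ω

/-- The operator `∂̄_I = (1/2) (∂/∂x + I ∂/∂y)` applied to `f_I` at the point `x + yI`,
where `z = x + iy`. -/
def dbar (f : ℍ → ℍ) (I : ℍ) (z : ℂ) : ℍ :=
  (1 / 2 : ℝ) • (fderiv ℝ (restrict f I) z 1 + I * fderiv ℝ (restrict f I) z Complex.I)

/-- `f` is slice regular on `Ω`: each `f_I` is of class `C¹` on `Ω_I` and `∂̄_I f` vanishes
identically there. -/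
def IsRegular (f : ℍ → ℍ) (Ω : Set ℍ) : Prop :=
  ∀ I ∈ imagUnits, ContDiffOn ℝ 1 (restrict f I) (slice Ω I) ∧
    ∀ z ∈ slice Ω I, dbar f I z = 0

/-- `f` is constant on the set `C`. -/
def IsConstantOn (f : ℍ → ℍ) (C : Set ℍ) : Prop := ∃ a : ℍ, ∀ q ∈ C, f q = a

/-- The degenerate set of `f : Ω → ℍ`: the union of the 2-spheres `x + y𝕊 ⊆ Ω`, `y ≠ 0`,
on which `f` is constant. -/
def degenerateSet (f : ℍ → ℍ) (Ω : Set ℍ) : Set ℍ :=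
  {q | ∃ x y : ℝ, y ≠ 0 ∧ sphere x y ⊆ Ω ∧ IsConstantOn f (sphere x y) ∧ q ∈ sphere x y}

end

end SliceRegular

namespace SliceRegular

open Quaternion Filter Topology

/-! Write `z = x + iy` with `x = q.re` and `y = vecNorm q`. Off the real axis, `q ∈ Ω` is degenerate
exactly when the values `f_I(z)`, `I ∈ 𝕊`, all agree (`mem_degenerateSet_iff`). These are equalities
of continuous functions of `q`, hence the relative closedness. For the interior, regularity makes
each `f_I` holomorphic for the complex structure on `ℍ` given by left multiplication by `L_I`. Near
an interior point of the degenerate set, `f_I(z) = f_I(z̄)`, so `f_I` is also antiholomorphic and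
its differential vanishes (`fderiv_eq_zero_of_conj`). The identity theorem makes `f_I` constant on
its slice, and the real points, common to all slices, carry the constant to every other slice
(`isConstantOn_of_slice`). -/

/-! ### Imaginary units, slices and spheres -/

theorem mem_imagUnits_iff {q : ℍ} :
    q ∈ imagUnits ↔ q.re = 0 ∧ q.imI ^ 2 + q.imJ ^ 2 + q.imK ^ 2 = 1 := by
  simp only [imagUnits, Set.mem_ofPred_eq, pow_two, Quaternion.ext_iff]
  simp only [Quaternion.re_mul, Quaternion.imI_mul, Quaternion.imJ_mul, Quaternion.imK_mul,
    Quaternion.re_neg, Quaternion.imI_neg, Quaternion.imJ_neg, Quaternion.imK_neg,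
    Quaternion.re_one, Quaternion.imI_one, Quaternion.imJ_one, Quaternion.imK_one]
  constructor
  · rintro ⟨h0, h1, h2, h3⟩
    have hre : q.re = 0 := by
      by_contra hne
      have e1 : q.imI = 0 := by
        have : q.re * q.imI = 0 := by linarith
        simpa [hne] using this
      have e2 : q.imJ = 0 := by
        have : q.re * q.imJ = 0 := by linarith
        simpa [hne] using this
      have e3 : q.imK = 0 := by
        have : q.re * q.imK = 0 := by linarith
        simpa [hne] using this
      rw [e1, e2, e3] at h0
      nlinarith [mul_self_nonneg q.re]
    refine ⟨hre, ?_⟩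
    rw [hre] at h0
    linarith
  · rintro ⟨h0, h1⟩
    rw [h0]
    refine ⟨by linarith, by ring, by ring, by ring⟩

theorem imagUnits_nonempty : (imagUnits).Nonempty :=
  ⟨⟨0, 1, 0, 0⟩, mem_imagUnits_iff.2 ⟨rfl, by norm_num⟩⟩

theorem mul_self_of_mem_imagUnits {I : ℍ} (hI : I ∈ imagUnits) : I * I = -1 := by
  rw [← pow_two]; exact hI

theorem toPlane_add (I : ℍ) (z w : ℂ) : toPlane I (z + w) = toPlane I z + toPlane I w := by
  simp only [toPlane, Complex.add_re, Complex.add_im, Quaternion.coe_add, add_mul]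
  abel

theorem toPlane_ofReal (I : ℍ) (t : ℝ) : toPlane I (t : ℂ) = (t : ℍ) := by
  simp [toPlane]

theorem toPlane_mul {I : ℍ} (hI : I ∈ imagUnits) (z w : ℂ) :
    toPlane I (z * w) = toPlane I z * toPlane I w := by
  have h := mul_self_of_mem_imagUnits hI
  have h0 : (w.im : ℍ) * I = I * (w.im : ℍ) := (Quaternion.coe_commutes _ _)
  have h1 : (w.re : ℍ) * I = I * (w.re : ℍ) := (Quaternion.coe_commutes _ _)
  have e : (z.im : ℍ) * I * ((w.im : ℍ) * I) = -((z.im : ℍ) * (w.im : ℍ)) := by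
    rw [h0, mul_assoc, ← mul_assoc I I, h]; simp
  have e' : (z.im : ℍ) * I * (w.re : ℍ) = ((z.im : ℍ) * (w.re : ℍ)) * I := by
    rw [mul_assoc, ← h1, mul_assoc]
  simp only [toPlane, Complex.mul_re, Complex.mul_im, Quaternion.coe_add, Quaternion.coe_sub,
    Quaternion.coe_mul, add_mul, mul_add, e, e', mul_assoc]
  abel

theorem mem_sphere_iff {x y : ℝ} {q : ℍ} :
    q ∈ sphere x y ↔ q.re = x ∧ q.imI ^ 2 + q.imJ ^ 2 + q.imK ^ 2 = y ^ 2 := by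
  constructor
  · rintro ⟨J, hJ, rfl⟩
    obtain ⟨h0, h1⟩ := mem_imagUnits_iff.1 hJ
    refine ⟨by simp [h0], ?_⟩
    simp only [Quaternion.imI_add, Quaternion.imJ_add, Quaternion.imK_add, Quaternion.imI_coe,
      Quaternion.imJ_coe, Quaternion.imK_coe, Quaternion.coe_mul_eq_smul, Quaternion.imI_smul,
      Quaternion.imJ_smul, Quaternion.imK_smul, smul_eq_mul]
    linear_combination y ^ 2 * h1
  · rintro ⟨rfl, h⟩
    by_cases hy : y = 0
    · subst hy
      obtain ⟨J, hJ⟩ := imagUnits_nonempty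
      -- The sphere is a single real point, so any unit serves.
      refine ⟨J, hJ, ?_⟩
      have e1 : q.imI = 0 := by nlinarith [sq_nonneg q.imI, sq_nonneg q.imJ, sq_nonneg q.imK]
      have e2 : q.imJ = 0 := by nlinarith [sq_nonneg q.imI, sq_nonneg q.imJ, sq_nonneg q.imK]
      have e3 : q.imK = 0 := by nlinarith [sq_nonneg q.imI, sq_nonneg q.imJ, sq_nonneg q.imK]
      ext <;> simp [e1, e2, e3]
    · refine ⟨y⁻¹ • q.im, mem_imagUnits_iff.2 ⟨by simp, ?_⟩, ?_⟩
      · simp only [Quaternion.imI_smul, Quaternion.imJ_smul, Quaternion.imK_smul,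
          Quaternion.imI_im, Quaternion.imJ_im, Quaternion.imK_im, smul_eq_mul]
        field_simp
        linarith
      · rw [Quaternion.coe_mul_eq_smul, smul_inv_smul₀ hy, Quaternion.re_add_im]

theorem toPlane_mem_sphere {I : ℍ} (hI : I ∈ imagUnits) (z : ℂ) :
    toPlane I z ∈ sphere z.re z.im := ⟨I, hI, rfl⟩

/-- Euclidean length of the vector part. -/
noncomputable def vecNorm (q : ℍ) : ℝ := √(q.imI ^ 2 + q.imJ ^ 2 + q.imK ^ 2)

theorem vecNorm_sq (q : ℍ) : vecNorm q ^ 2 = q.imI ^ 2 + q.imJ ^ 2 + q.imK ^ 2 :=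
  Real.sq_sqrt (by positivity)

theorem mem_sphere_vecNorm (q : ℍ) : q ∈ sphere q.re (vecNorm q) :=
  mem_sphere_iff.2 ⟨rfl, (vecNorm_sq q).symm⟩

theorem sphere_eq_of_mem {x y : ℝ} {q : ℍ} (h : q ∈ sphere x y) :
    sphere x y = sphere q.re (vecNorm q) := by
  obtain ⟨h0, h1⟩ := mem_sphere_iff.1 h
  ext p
  rw [mem_sphere_iff, mem_sphere_iff, vecNorm_sq, h0, h1]

theorem vecNorm_ne_zero {q : ℍ} (hq : q ∉ realAxis) : vecNorm q ≠ 0 := by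
  intro h
  obtain ⟨J, -, e⟩ := mem_sphere_vecNorm q
  exact hq ⟨q.re, by rw [h] at e; simpa using e.symm⟩

theorem continuous_re_vecNorm : Continuous fun q : ℍ => (⟨q.re, vecNorm q⟩ : ℂ) := by
  have : Continuous fun q : ℍ => ((q.re : ℂ) + (vecNorm q : ℂ) * Complex.I) := by
    unfold vecNorm
    have h0 := Quaternion.continuous_re
    have h1 := Quaternion.continuous_imI
    have h2 := Quaternion.continuous_imJ
    have h3 := Quaternion.continuous_imK
    fun_prop
  convert this using 2 with q
  apply Complex.ext <;> simp

theorem continuous_toPlane (I : ℍ) : Continuous (toPlane I) := by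
  unfold toPlane
  have h : Continuous fun t : ℝ => (t : ℍ) := Quaternion.continuous_coe
  have h1 : Continuous fun z : ℂ => (z.re : ℍ) := h.comp Complex.continuous_re
  have h2 : Continuous fun z : ℂ => (z.im : ℍ) := h.comp Complex.continuous_im
  exact h1.add (h2.mul continuous_const)

theorem sphere_subset_of_mem {Ω : Set ℍ} (hΩ : IsSymmetric Ω) {q : ℍ} (hq : q ∈ Ω) :
    sphere q.re (vecNorm q) ⊆ Ω := by
  obtain ⟨J, hJ, e⟩ := mem_sphere_vecNorm q
  exact hΩ _ _ J hJ (e ▸ hq)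

/-! ### The degenerate set and its closedness -/

theorem degenerateSet_subset (f : ℍ → ℍ) (Ω : Set ℍ) : degenerateSet f Ω ⊆ Ω \ realAxis := by
  rintro q ⟨x, y, hy, hs, -, hq⟩
  refine ⟨hs hq, ?_⟩
  rintro ⟨t, rfl⟩
  have := (mem_sphere_iff.1 hq).2
  simp at this
  exact hy ((pow_eq_zero_iff two_ne_zero).1 this.symm)

/-- Symmetry puts the whole sphere through `q` inside `Ω`, so the existential over spheres becomes a
family of equations in `q`. -/
theorem mem_degenerateSet_iff {f : ℍ → ℍ} {Ω : Set ℍ} (hΩ : IsSymmetric Ω) {q : ℍ}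
    (hq : q ∈ Ω \ realAxis) :
    q ∈ degenerateSet f Ω ↔ ∀ I ∈ imagUnits, ∀ J ∈ imagUnits,
      restrict f I ⟨q.re, vecNorm q⟩ = restrict f J ⟨q.re, vecNorm q⟩ := by
  constructor
  · rintro ⟨x, y, -, -, ⟨a, ha⟩, hm⟩ I hI J hJ
    rw [sphere_eq_of_mem hm] at ha
    exact (ha _ ⟨I, hI, rfl⟩).trans (ha _ ⟨J, hJ, rfl⟩).symm
  · intro h
    obtain ⟨I, hI⟩ := imagUnits_nonempty
    refine ⟨q.re, vecNorm q, vecNorm_ne_zero hq.2, sphere_subset_of_mem hΩ hq.1,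
      ⟨restrict f I ⟨q.re, vecNorm q⟩, ?_⟩, mem_sphere_vecNorm q⟩
    rintro p ⟨J, hJ, rfl⟩
    exact h J hJ I hI

theorem isClosed_degenerateSet {f : ℍ → ℍ} {Ω : Set ℍ} (hΩ : IsSymmetric Ω)
    (hf : IsRegular f Ω) :
    IsClosed ((fun q : ↥(Ω \ realAxis) => (q : ℍ)) ⁻¹' degenerateSet f Ω) := by
  have hc : ∀ I ∈ imagUnits, Continuous fun q : ↥(Ω \ realAxis) =>
      restrict f I ⟨(q : ℍ).re, vecNorm (q : ℍ)⟩ := fun I hI =>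
    (hf I hI).1.continuousOn.comp_continuous
      (continuous_re_vecNorm.comp continuous_subtype_val)
      fun q => sphere_subset_of_mem hΩ q.2.1 ⟨I, hI, rfl⟩
  have e : (fun q : ↥(Ω \ realAxis) => (q : ℍ)) ⁻¹' degenerateSet f Ω =
      ⋂ I ∈ imagUnits, ⋂ J ∈ imagUnits, {q : ↥(Ω \ realAxis) |
        restrict f I ⟨(q : ℍ).re, vecNorm (q : ℍ)⟩ =
          restrict f J ⟨(q : ℍ).re, vecNorm (q : ℍ)⟩} := by
    ext q
    simp only [Set.mem_preimage, mem_degenerateSet_iff hΩ q.2, Set.mem_iInter, Set.mem_ofPred_eq]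
  rw [e]
  exact isClosed_biInter fun I hI => isClosed_biInter fun J hJ => isClosed_eq (hc I hI) (hc J hJ)

/-! ### Holomorphy on slices -/

/-- The complex normed space structure on `ℍ` given by left multiplication by elements of `L_I`. -/
@[reducible] noncomputable def leftNormedSpace {I : ℍ} (hI : I ∈ imagUnits) :
    NormedSpace ℂ ℍ where
  smul z q := toPlane I z * q
  one_smul q := show toPlane I 1 * q = q by simp [toPlane]
  mul_smul z w q := show toPlane I (z * w) * q = toPlane I z * (toPlane I w * q) by
    rw [toPlane_mul hI, mul_assoc]
  smul_zero z := mul_zero (toPlane I z)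
  smul_add z p q := mul_add (toPlane I z) p q
  add_smul z w q := show toPlane I (z + w) * q = toPlane I z * q + toPlane I w * q by
    rw [toPlane_add, add_mul]
  zero_smul q := show toPlane I 0 * q = 0 by simp [toPlane]
  norm_smul_le z q := by
    change ‖toPlane I z * q‖ ≤ ‖z‖ * ‖q‖
    have h : ‖toPlane I z‖ ^ 2 = ‖z‖ ^ 2 := by
      obtain ⟨h0, h1⟩ := mem_sphere_iff.1 (toPlane_mem_sphere hI z)
      rw [pow_two, ← Quaternion.normSq_eq_norm_mul_self, Quaternion.normSq_def', Complex.sq_norm,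
        Complex.normSq_apply, h0]
      linarith
    rw [norm_mul, (sq_eq_sq₀ (norm_nonneg _) (norm_nonneg _)).1 h]

theorem IsRegular.differentiableAt {f : ℍ → ℍ} {Ω : Set ℍ} (hf : IsRegular f Ω) {I : ℍ}
    (hI : I ∈ imagUnits) (ho : IsOpen (slice Ω I)) {z : ℂ} (hz : z ∈ slice Ω I) :
    DifferentiableAt ℝ (restrict f I) z :=
  ((hf I hI).1.contDiffAt (ho.mem_nhds hz)).differentiableAt one_ne_zero

theorem IsRegular.fderiv_I {f : ℍ → ℍ} {Ω : Set ℍ} (hf : IsRegular f Ω) {I : ℍ}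
    (hI : I ∈ imagUnits) {z : ℂ} (hz : z ∈ slice Ω I) :
    fderiv ℝ (restrict f I) z Complex.I = I * fderiv ℝ (restrict f I) z 1 := by
  have h := (hf I hI).2 z hz
  rw [dbar, smul_eq_zero_iff_right (by norm_num), add_eq_zero_iff_eq_neg] at h
  rw [h, mul_neg, ← mul_assoc, mul_self_of_mem_imagUnits hI]
  simp

theorem fderiv_apply_eq (L : ℂ →L[ℝ] ℍ) (w : ℂ) :
    L w = (w.re : ℍ) * L 1 + (w.im : ℍ) * L Complex.I := by
  have : w = w.re • (1 : ℂ) + w.im • Complex.I := by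
    apply Complex.ext <;> simp
  conv_lhs => rw [this]
  rw [map_add, map_smul, map_smul, Quaternion.coe_mul_eq_smul, Quaternion.coe_mul_eq_smul]

/-- The equation `∂̄_I f = 0` says that the real differential is complex linear for `leftNormedSpace
hI`, so Cauchy theory for vector-valued functions applies. -/
theorem IsRegular.analyticOnNhd {f : ℍ → ℍ} {Ω : Set ℍ} (hf : IsRegular f Ω) {I : ℍ}
    (hI : I ∈ imagUnits) (ho : IsOpen (slice Ω I)) :
    letI := leftNormedSpace hI
    AnalyticOnNhd ℂ (restrict f I) (slice Ω I) := by
  let := leftNormedSpace hI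
  refine DifferentiableOn.analyticOnNhd (fun z hz => ?_) ho
  have h := (hf.differentiableAt hI ho hz).hasFDerivAt
  have hd : HasDerivAt (restrict f I) (fderiv ℝ (restrict f I) z 1) z := by
    rw [hasDerivAt_iff_isLittleO]
    refine h.isLittleO.congr_left fun w => ?_
    congr 1
    rw [fderiv_apply_eq, hf.fderiv_I hI hz]
    change _ = toPlane I (w - z) * _
    rw [toPlane, add_mul, mul_assoc]
  exact hd.differentiableAt.differentiableWithinAt

theorem IsRegular.eqOn_const {f : ℍ → ℍ} {Ω : Set ℍ} (hf : IsRegular f Ω) {I : ℍ}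
    (hI : I ∈ imagUnits) (ho : IsOpen (slice Ω I)) (hc : IsConnected (slice Ω I)) {z : ℂ}
    (hz : z ∈ slice Ω I) {a : ℍ} (h : ∃ᶠ w in 𝓝[≠] z, restrict f I w = a) :
    Set.EqOn (restrict f I) (fun _ => a) (slice Ω I) := by
  let := leftNormedSpace hI
  exact (hf.analyticOnNhd hI ho).eqOn_of_preconnected_of_frequently_eq
    analyticOnNhd_const hc.isPreconnected hz h

/-! ### Empty interior -/

theorem fderiv_eq_zero_of_conj {f : ℍ → ℍ} {Ω : Set ℍ} (hf : IsRegular f Ω) {I : ℍ}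
    (hI : I ∈ imagUnits) (ho : IsOpen (slice Ω I)) {z : ℂ} (hz : z ∈ slice Ω I)
    (hz' : (starRingEnd ℂ) z ∈ slice Ω I)
    (h : restrict f I =ᶠ[𝓝 z] fun w => restrict f I ((starRingEnd ℂ) w)) :
    fderiv ℝ (restrict f I) z = 0 := by
  set L := fderiv ℝ (restrict f I) z with hL
  set M := fderiv ℝ (restrict f I) ((starRingEnd ℂ) z) with hM
  have hLM : L = M.comp (Complex.conjCLE : ℂ →L[ℝ] ℂ) := by
    have h1 : HasFDerivAt (restrict f I) M (Complex.conjCLE z) :=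
      (hf.differentiableAt hI ho hz').hasFDerivAt
    have h2 := h1.comp z (Complex.conjCLE.hasFDerivAt)
    exact (h2.congr_of_eventuallyEq h).fderiv
  have e1 : L 1 = M 1 := by rw [hLM]; simp
  have e2 : L Complex.I = - M Complex.I := by rw [hLM]; simp
  -- Cauchy–Riemann at both `z` and `z̄` turns `e2` into `I * M 1 = -(I * M 1)`.
  rw [hL, hf.fderiv_I hI hz, ← hL, hM, hf.fderiv_I hI hz', ← hM, e1] at e2
  have e3 : I * M 1 = 0 := by
    have h3 : (2 : ℝ) • (I * M 1) = 0 := by rw [two_smul]; exact eq_neg_iff_add_eq_zero.1 e2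
    exact (smul_eq_zero_iff_right two_ne_zero).1 h3
  have e4 : L 1 = 0 := by
    have e5 : I * (I * M 1) = 0 := by rw [e3, mul_zero]
    rw [← mul_assoc, mul_self_of_mem_imagUnits hI] at e5
    rw [e1]
    simpa using e5
  ext1 w
  rw [fderiv_apply_eq, hL, hf.fderiv_I hI hz, ← hL, e4]
  simp

theorem conj_of_mem_degenerateSet {f : ℍ → ℍ} {Ω : Set ℍ} {I : ℍ} (hI : I ∈ imagUnits) {z : ℂ}
    (hz : toPlane I z ∈ degenerateSet f Ω) :
    (starRingEnd ℂ) z ∈ slice Ω I ∧ restrict f I z = restrict f I ((starRingEnd ℂ) z) := by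
  obtain ⟨x, y, -, hs, ⟨a, ha⟩, hm⟩ := hz
  have h1 := mem_sphere_iff.1 hm
  have h2 := mem_sphere_iff.1 (toPlane_mem_sphere hI z)
  have hm' : toPlane I ((starRingEnd ℂ) z) ∈ sphere x y := by
    have h3 := mem_sphere_iff.1 (toPlane_mem_sphere hI ((starRingEnd ℂ) z))
    simp only [Complex.conj_re, Complex.conj_im, neg_sq] at h3
    exact mem_sphere_iff.2 ⟨h3.1.trans (h2.1.symm.trans h1.1), h3.2.trans (h2.2.symm.trans h1.2)⟩
  exact ⟨hs hm', (ha _ hm).trans (ha _ hm').symm⟩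

theorem eventually_const_of_mem_interior {f : ℍ → ℍ} {Ω : Set ℍ} (hf : IsRegular f Ω) {I : ℍ}
    (hI : I ∈ imagUnits) (ho : IsOpen (slice Ω I)) {z : ℂ}
    (hz : toPlane I z ∈ interior (degenerateSet f Ω)) :
    restrict f I =ᶠ[𝓝 z] fun _ => restrict f I z := by
  set V : Set ℂ := toPlane I ⁻¹' interior (degenerateSet f Ω) with hV
  have hVo : IsOpen V := isOpen_interior.preimage (continuous_toPlane I)
  have hVD : ∀ w ∈ V, toPlane I w ∈ degenerateSet f Ω := fun w hw => interior_subset hw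
  have hVΩ : ∀ w ∈ V, w ∈ slice Ω I := fun w hw => (degenerateSet_subset f Ω (hVD w hw)).1
  have hd : ∀ w ∈ V, fderiv ℝ (restrict f I) w = 0 := fun w hw =>
    fderiv_eq_zero_of_conj hf hI ho (hVΩ w hw) (conj_of_mem_degenerateSet hI (hVD w hw)).1
      (Filter.eventually_of_mem (hVo.mem_nhds hw)
        fun v hv => (conj_of_mem_degenerateSet hI (hVD v hv)).2)
  obtain ⟨r, hr, hball⟩ := Metric.isOpen_iff.1 hVo z hz
  filter_upwards [Metric.ball_mem_nhds z hr] with w hw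
  exact Metric.isOpen_ball.is_const_of_fderiv_eq_zero
    (convex_ball z r).isPreconnected
    (fun v hv => (hf.differentiableAt hI ho (hVΩ v (hball hv))).differentiableWithinAt)
    (fun v hv => hd v (hball hv)) hw (Metric.mem_ball_self hr)

theorem isConstantOn_of_slice {f : ℍ → ℍ} {Ω : Set ℍ} (hΩ : IsSliceDomain Ω)
    (hf : IsRegular f Ω) {I : ℍ} {a : ℍ}
    (h : Set.EqOn (restrict f I) (fun _ => a) (slice Ω I)) : IsConstantOn f Ω := by
  refine ⟨a, fun q hq => ?_⟩
  obtain ⟨J, hJ, e⟩ := mem_sphere_vecNorm q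
  obtain ⟨_, hr, r, rfl⟩ := hΩ.inter_realAxis
  have hr' : (r : ℂ) ∈ slice Ω J := by
    change toPlane J (r : ℂ) ∈ Ω
    rwa [toPlane_ofReal]
  -- Real points accumulate at `r` inside the slice, which is all that the identity theorem
  -- requires.
  have ht : Tendsto (fun t : ℝ => (t : ℂ)) (𝓝[≠] r) (𝓝[≠] (r : ℂ)) :=
    Complex.continuous_ofReal.continuousAt.continuousWithinAt.tendsto_nhdsWithin
      fun t ht => by simpa using ht
  have hev : ∀ᶠ t : ℝ in 𝓝[≠] r, restrict f J (t : ℂ) = a := by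
    have : ∀ᶠ t : ℝ in 𝓝 r, (t : ℂ) ∈ slice Ω J :=
      Complex.continuous_ofReal.continuousAt.eventually ((hΩ.isOpen_slice J hJ).mem_nhds hr')
    filter_upwards [nhdsWithin_le_nhds this] with t ht
    have hm : (t : ℂ) ∈ slice Ω I := by
      change toPlane I (t : ℂ) ∈ Ω
      rw [toPlane_ofReal, ← toPlane_ofReal J]
      exact ht
    have := h hm
    simpa only [restrict, toPlane_ofReal] using this
  have hJa := hf.eqOn_const hJ (hΩ.isOpen_slice J hJ) (hΩ.isConnected_slice J hJ) hr'
    (ht.frequently hev.frequently)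
  have hq' : (⟨q.re, vecNorm q⟩ : ℂ) ∈ slice Ω J := by
    change (q.re : ℍ) + (vecNorm q : ℍ) * J ∈ Ω
    rwa [← e]
  have := hJa hq'
  change f ((q.re : ℍ) + (vecNorm q : ℍ) * J) = a at this
  rwa [← e] at this

theorem interior_degenerateSet {f : ℍ → ℍ} {Ω : Set ℍ} (hΩ : IsSliceDomain Ω)
    (hf : IsRegular f Ω) (hnc : ¬ IsConstantOn f Ω) : interior (degenerateSet f Ω) = ∅ := by
  by_contra hne
  obtain ⟨q, hq⟩ := Set.nonempty_iff_ne_empty.2 hne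
  obtain ⟨I, hI, e⟩ := mem_sphere_vecNorm q
  have ho := hΩ.isOpen_slice I hI
  have hz : toPlane I ⟨q.re, vecNorm q⟩ ∈ interior (degenerateSet f Ω) := by
    change (q.re : ℍ) + (vecNorm q : ℍ) * I ∈ _
    rwa [← e]
  have hev := eventually_const_of_mem_interior hf hI ho hz
  exact hnc (isConstantOn_of_slice hΩ hf (hf.eqOn_const hI ho (hΩ.isConnected_slice I hI)
    (degenerateSet_subset f Ω (interior_subset hz)).1
    (hev.filter_mono nhdsWithin_le_nhds).frequently))

end SliceRegular

theorem mainTheorem7 (Ω : Set (Quaternion ℝ)) (hΩ : SliceRegular.IsSymmetricSliceDomain Ω)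
    (f : Quaternion ℝ → Quaternion ℝ) (hf : SliceRegular.IsRegular f Ω)
    (hnc : ¬ SliceRegular.IsConstantOn f Ω) :
    SliceRegular.degenerateSet f Ω ⊆ Ω \ SliceRegular.realAxis ∧
    IsClosed ((fun q : ↥(Ω \ SliceRegular.realAxis) => (q : Quaternion ℝ)) ⁻¹'
      SliceRegular.degenerateSet f Ω) ∧
    interior (SliceRegular.degenerateSet f Ω) = ∅ :=
  ⟨SliceRegular.degenerateSet_subset f Ω, SliceRegular.isClosed_degenerateSet hΩ.2 hf,
    SliceRegular.interior_degenerateSet hΩ.1 hf hnc⟩
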